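/- **Theorem 3.2 (SURE for lava in regression).** Let $n\ge 1$, let $X$ be a fixed $n\times p$ real matrix, $\theta_0\in\mathbb R^p$, $\sigma_u>0$, and let $\lambda_1,\lambda_2\ge 0$ be penalty levels such that $X'X+n\lambda_2I_p$ is invertible (which is automatic if $\lambda_2>0$). Suppose $Y\sim N(X\theta_0,\sigma_u^2I_n)$. For data $y\in\mathbb R^n$ let $(\widehat\beta(y),\widehat\delta(y))$ be a minimizer of $$(\beta,\delta)\mapsto \frac1n\|y-X(\beta+\delta)\|_2^2+\lambda_2\|\beta\|_2^2+\lambda_1\|\delta\|_1,\qquad \beta,\delta\in\mathbb R^p$$ (any minimizer if there are several), and let $\widehat\theta_{\mathrm{lava}}=\widehat\beta(Y)+\widehat\delta(Y)$ be the lava estimator. Put $$P_{\lambda_2}=X(X'X+n\lambda_2I_p)^{-1}X',\qquad K_{\lambda_2}=I_n-P_{\lambda_2},\qquad \widetilde X=K_{\lambda_2}^{1/2}X .$$ Let $\widehat J=\{j:\widehat\delta_j\ne0\}$ be the active set of $\widehat\delta=\widehat\delta(Y)$, let $\widetilde X_{\widehat J}$ be the submatrix of $\widetilde X$ formed by the columns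 with index in $\widehat J$, and let $$\widetilde K_{\widehat J}=I_n-\widetilde X_{\widehat J}(\widetilde X_{\widehat J}'\widetilde X_{\widehat J})^{-}\widetilde X_{\widehat J}',$$ where $A^-$ is the Moore–Penrose pseudo-inverse. Then, all expectations below being finite: 1. The degrees of freedom $\mathrm{df}(\widehat\theta_{\mathrm{lava}})=\sigma_u^{-2}\,\mathrm E[(Y-X\theta_0)'X\widehat\theta_{\mathrm{lava}}]$ of the lava fit satisfy $$\mathrm{df}(\widehat\theta_{\mathrm{lava}})=\mathrm E\big[\mathrm{rank}(\widetilde X_{\widehat J})+\mathrm{tr}(\widetilde K_{\widehat J}P_{\lambda_2})\big].$$ 2. Stein's unbiased risk estimate of the prediction risk $\mathrm E\frac1n\|X\widehat\theta_{\mathrm{lava}}-X\theta_0\|_2^2$ is $$\widehat R=-\sigma_u^2+\frac1n\|X\widehat\theta_{\mathrm{lava}}-Y\|_2^2+\frac{2\sigma_u^2}{n}\mathrm{rank}(\widetilde X_{\widehat J})+\frac{2\sigma_u^2}{n}\mathrm{tr}(\widetilde K_{\widehat J}P_{\lambda_2}).$$ That is, with $f(y)=X(\widehat\beta(y)+\widehat\delta(y))$,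 almost surely $f$ is differentiable at $Y$ and $\widehat R=-\sigma_u^2+\frac1n\|f(Y)-Y\|_2^2+\frac{2\sigma_u^2}{n}\sum_{i=1}^n\frac{\partial f_i}{\partial y_i}(Y)$; and $$\mathrm E\,\widehat R=\mathrm E\,\tfrac1n\|X\widehat\theta_{\mathrm{lava}}-X\theta_0\|_2^2 .$$ -/

import Mathlib

open MeasureTheory ProbabilityTheory
open scoped MatrixOrder Matrix

namespace Lava

/-! ### The Moore-Penrose pseudo-inverse of a real matrix -/

/-- The four Penrose equations: `B` is a Moore-Penrose pseudo-inverse of the real matrix `A`. -/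
structure IsMoorePenrose {m k : Type*} [Fintype m] [Fintype k]
    (A : Matrix m k ℝ) (B : Matrix k m ℝ) : Prop where
  mul_mul_left : A * B * A = A
  mul_mul_right : B * A * B = B
  symm_left : (A * B)ᵀ = A * B
  symm_right : (B * A)ᵀ = B * A

theorem IsMoorePenrose.unique {m k : Type*} [Fintype m] [Fintype k]
    {A : Matrix m k ℝ} {B C : Matrix k m ℝ}
    (hB : IsMoorePenrose A B) (hC : IsMoorePenrose A C) : B = C := by
  have h1 : A * B = A * C := by
    calc A * B = (A * B)ᵀ := hB.symm_left.symm
      _ = ((A * C) * (A * B))ᵀ := by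
          rw [← Matrix.mul_assoc, hC.mul_mul_left]
      _ = (A * B) * (A * C) := by
          rw [Matrix.transpose_mul, hB.symm_left, hC.symm_left]
      _ = A * C := by rw [← Matrix.mul_assoc, hB.mul_mul_left]
  have h2 : B * A = C * A := by
    calc B * A = (B * A)ᵀ := hB.symm_right.symm
      _ = ((B * A) * (C * A))ᵀ := by
          rw [Matrix.mul_assoc B A, ← Matrix.mul_assoc A C A, hC.mul_mul_left]
      _ = (C * A) * (B * A) := by
          rw [Matrix.transpose_mul, hB.symm_right, hC.symm_right]
      _ = C * A := by
          rw [Matrix.mul_assoc C A, ← Matrix.mul_assoc A B A, hB.mul_mul_left]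
  calc B = B * A * B := hB.mul_mul_right.symm
    _ = C * (A * B) := by rw [h2, Matrix.mul_assoc]
    _ = C := by rw [h1, ← Matrix.mul_assoc, hC.mul_mul_right]

theorem exists_isMoorePenrose {m k : Type*} [Fintype m] [Fintype k]
    (A : Matrix m k ℝ) : ∃ B, IsMoorePenrose A B := by
  classical
  set H : Matrix k k ℝ := Aᵀ * A with hH
  have hHs : IsSelfAdjoint H := by
    have := Matrix.isHermitian_conjTranspose_mul_self A
    rwa [Matrix.conjTranspose_eq_transpose_of_trivial] at this
  have hfin : (spectrum ℝ H).Finite := Matrix.finite_real_spectrum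
  set G : Matrix k k ℝ := cfc (fun x : ℝ => x⁻¹) H with hG
  have hGs : Gᵀ = G := by
    have := cfc_predicate (R := ℝ) (fun x : ℝ => x⁻¹) H
    have h2 : star G = G := this
    rwa [Matrix.star_eq_conjTranspose, Matrix.conjTranspose_eq_transpose_of_trivial] at h2
  have hHt : Hᵀ = H := by rw [hH, Matrix.transpose_mul, Matrix.transpose_transpose]
  have hGH : G * H = cfc (fun x : ℝ => x⁻¹ * x) H := by
    conv_lhs => rw [hG]; arg 2; rw [← cfc_id' ℝ H]
    rw [← cfc_mul _ _ H (hfin.continuousOn _) (hfin.continuousOn _)]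
  have hHG : H * G = cfc (fun x : ℝ => x⁻¹ * x) H := by
    conv_lhs => rw [hG]; arg 1; rw [← cfc_id' ℝ H]
    rw [← cfc_mul _ _ H (hfin.continuousOn _) (hfin.continuousOn _)]
    congr 1; ext x; ring
  have hHGH : H * (G * H) = H := by
    rw [hGH]
    conv_lhs => arg 1; rw [← cfc_id' ℝ H]
    rw [← cfc_mul _ _ H (hfin.continuousOn _) (hfin.continuousOn _)]
    conv_rhs => rw [← cfc_id' ℝ H]
    congr 1; ext x
    by_cases hx : x = 0
    · simp [hx]
    · field_simp
  have hGHG : G * H * G = G := by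
    rw [hGH]
    conv_lhs => rw [hG]
    rw [← cfc_mul _ _ H (hfin.continuousOn _) (hfin.continuousOn _), hG]
    congr 1; ext x
    by_cases hx : x = 0
    · simp [hx]
    · field_simp
  have hA : A * (G * H) = A := by
    have h0 : A * (G * H) - A = 0 := by
      rw [← Matrix.conjTranspose_mul_self_eq_zero,
        Matrix.conjTranspose_eq_transpose_of_trivial]
      have e : A * (G * H) - A = A * (G * H - 1) := by rw [Matrix.mul_sub, Matrix.mul_one]
      rw [e, Matrix.transpose_mul, Matrix.mul_assoc, ← Matrix.mul_assoc Aᵀ A, ← hH,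
        Matrix.mul_sub, hHGH, Matrix.mul_one, sub_self, Matrix.mul_zero]
    exact sub_eq_zero.mp h0
  refine ⟨G * Aᵀ, ?_, ?_, ?_, ?_⟩
  · rw [Matrix.mul_assoc, Matrix.mul_assoc, ← hH, hA]
  · rw [Matrix.mul_assoc G Aᵀ A, ← hH, ← Matrix.mul_assoc, hGHG]
  · rw [Matrix.transpose_mul, Matrix.transpose_mul, Matrix.transpose_transpose, hGs,
      Matrix.mul_assoc]
  · rw [Matrix.mul_assoc, ← hH, Matrix.transpose_mul, hGs, hHt, hHG, hGH]

/-- The Moore-Penrose pseudo-inverse `A⁻` of a real matrix: the unique solution of the Penrose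
equations. -/
noncomputable def pinv {m k : Type*} [Fintype m] [Fintype k] (A : Matrix m k ℝ) :
    Matrix k m ℝ :=
  Classical.choose (exists_isMoorePenrose A)

theorem pinv_spec {m k : Type*} [Fintype m] [Fintype k] (A : Matrix m k ℝ) :
    IsMoorePenrose A (pinv A) :=
  Classical.choose_spec (exists_isMoorePenrose A)

/-! ### The lava estimator -/

/-- `X v` as a vector of Euclidean space. -/
noncomputable def apply {n p : ℕ} (X : Matrix (Fin n) (Fin p) ℝ) (v : EuclideanSpace ℝ (Fin p)) :
    EuclideanSpace ℝ (Fin n) :=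
  WithLp.toLp 2 (X *ᵥ v.ofLp)

/-- The lava criterion
`(1/n) ‖y - X(β + δ)‖₂² + lam₂ ‖β‖₂² + lam₁ ‖δ‖₁`. -/
noncomputable def objective {n p : ℕ} (X : Matrix (Fin n) (Fin p) ℝ) (lam₁ lam₂ : ℝ)
    (y : EuclideanSpace ℝ (Fin n)) (β δ : EuclideanSpace ℝ (Fin p)) : ℝ :=
  (1 / (n : ℝ)) * ‖y - apply X (β + δ)‖ ^ 2 + lam₂ * ‖β‖ ^ 2 + lam₁ * ∑ j, |δ j|

/-- `(β, δ)` is a global minimiser of the lava criterion on the data `(y, X)`. -/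
def IsLavaSolution {n p : ℕ} (X : Matrix (Fin n) (Fin p) ℝ) (lam₁ lam₂ : ℝ)
    (y : EuclideanSpace ℝ (Fin n)) (β δ : EuclideanSpace ℝ (Fin p)) : Prop :=
  ∀ b d : EuclideanSpace ℝ (Fin p), objective X lam₁ lam₂ y β δ ≤ objective X lam₁ lam₂ y b d

/-- The matrix `X'X + n lam₂ I_p`. -/
def ridgeGram {n p : ℕ} (X : Matrix (Fin n) (Fin p) ℝ) (lam₂ : ℝ) :
    Matrix (Fin p) (Fin p) ℝ :=
  Xᵀ * X + ((n : ℝ) * lam₂) • (1 : Matrix (Fin p) (Fin p) ℝ)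

/-- The ridge-projection matrix `P = X (X'X + n lam₂ I_p)⁻¹ X'`. -/
noncomputable def ridgeP {n p : ℕ} (X : Matrix (Fin n) (Fin p) ℝ) (lam₂ : ℝ) :
    Matrix (Fin n) (Fin n) ℝ :=
  X * (ridgeGram X lam₂)⁻¹ * Xᵀ

/-- The residual matrix `K = I_n - P`. -/
noncomputable def ridgeK {n p : ℕ} (X : Matrix (Fin n) (Fin p) ℝ) (lam₂ : ℝ) :
    Matrix (Fin n) (Fin n) ℝ :=
  1 - ridgeP X lam₂

/-- The transformed design `X̃ = K^{1/2} X`, with the positive semidefinite square root. -/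
noncomputable def tildeX {n p : ℕ} (X : Matrix (Fin n) (Fin p) ℝ) (lam₂ : ℝ) :
    Matrix (Fin n) (Fin p) ℝ :=
  CFC.sqrt (ridgeK X lam₂) * X

/-- The active set `{j : δ_j ≠ 0}`. -/
noncomputable def activeSet {p : ℕ} (δ : EuclideanSpace ℝ (Fin p)) : Finset (Fin p) :=
  Finset.univ.filter fun j => δ j ≠ 0

/-- The submatrix formed by the columns of `A` with index in `J`. -/
def columns {n p : ℕ} (A : Matrix (Fin n) (Fin p) ℝ) (J : Finset (Fin p)) :
    Matrix (Fin n) J ℝ :=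
  A.submatrix id Subtype.val

/-- `I - A_J (A_J' A_J)⁻ A_J'`. -/
noncomputable def residualProj {n p : ℕ} (A : Matrix (Fin n) (Fin p) ℝ) (J : Finset (Fin p)) :
    Matrix (Fin n) (Fin n) ℝ :=
  1 - columns A J * pinv ((columns A J)ᵀ * columns A J) * (columns A J)ᵀ

/-- `rank(X̃_J) + tr(K̃_J P)` for the active set `J` of `δ`. -/
noncomputable def dfTerm {n p : ℕ} (X : Matrix (Fin n) (Fin p) ℝ) (lam₂ : ℝ)
    (δ : EuclideanSpace ℝ (Fin p)) : ℝ :=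
  ((columns (tildeX X lam₂) (activeSet δ)).rank : ℝ)
    + (residualProj (tildeX X lam₂) (activeSet δ) * ridgeP X lam₂).trace

/-! ### Degrees of freedom and Stein's unbiased risk estimate -/

/-- Degrees of freedom of the mean fit `y ↦ fit y` when the mean of `Y` is `m` and its
covariance matrix is `σ² I`: `σ⁻² E[(Y - m)' fit(Y)]`. -/
noncomputable def degreesOfFreedom {Ω : Type*} [MeasurableSpace Ω] {n : ℕ} (P : Measure Ω)
    (Y : Ω → EuclideanSpace ℝ (Fin n)) (m : EuclideanSpace ℝ (Fin n)) (σ : ℝ)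
    (fit : EuclideanSpace ℝ (Fin n) → EuclideanSpace ℝ (Fin n)) : ℝ :=
  (1 / σ ^ 2) * ∫ ω, inner ℝ (Y ω - m) (fit (Y ω)) ∂P

/-- The divergence `∑ᵢ ∂fᵢ/∂yᵢ`, the trace of the Jacobian matrix of `f` at `y`. -/
noncomputable def divergence {n : ℕ} (f : EuclideanSpace ℝ (Fin n) → EuclideanSpace ℝ (Fin n))
    (y : EuclideanSpace ℝ (Fin n)) : ℝ :=
  ∑ i, (fderiv ℝ f y (EuclideanSpace.single i (1 : ℝ))) i

/-- Stein's unbiased risk estimate of `E (1/n) ‖fit(Y) - E Y‖²` at the data `y`: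
`-σ² + (1/n) ‖fit(y) - y‖² + (2σ²/n) div fit(y)`. -/
noncomputable def steinSURE {n : ℕ} (σ : ℝ)
    (fit : EuclideanSpace ℝ (Fin n) → EuclideanSpace ℝ (Fin n))
    (y : EuclideanSpace ℝ (Fin n)) : ℝ :=
  -σ ^ 2 + (1 / (n : ℝ)) * ‖fit y - y‖ ^ 2 + (2 * σ ^ 2 / (n : ℝ)) * divergence fit y

/-- The explicit risk estimate
`-σ² + (1/n) ‖X(β + δ) - y‖² + (2σ²/n) rank(X̃_J) + (2σ²/n) tr(K̃_J P)`,
with `J` the active set of `δ`. -/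
noncomputable def lavaSURE {n p : ℕ} (X : Matrix (Fin n) (Fin p) ℝ) (lam₂ σ : ℝ)
    (y : EuclideanSpace ℝ (Fin n)) (β δ : EuclideanSpace ℝ (Fin p)) : ℝ :=
  -σ ^ 2 + (1 / (n : ℝ)) * ‖apply X (β + δ) - y‖ ^ 2
    + (2 * σ ^ 2 / (n : ℝ)) * ((columns (tildeX X lam₂) (activeSet δ)).rank : ℝ)
    + (2 * σ ^ 2 / (n : ℝ)) *
      (residualProj (tildeX X lam₂) (activeSet δ) * ridgeP X lam₂).trace

end Lava

/-!
# Stein's unbiased risk estimate for the lava estimator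

The fit `f(y) = X(β̂(y) + δ̂(y))` is the proximal map of a convex penalty, so it is `1`-Lipschitz
(`lipschitzWith_fit`); in particular it does not depend on the chosen minimiser, and it is
differentiable almost everywhere.

The stationarity conditions in `β` and in the active coordinates of `δ` determine the fit in terms
of the active set `J` and the signs `s` of `δ̂_J`: it equals
`(P + K^{1/2} Π_J K^{1/2}) y + c(J, s)`, with `Π_J` the orthogonal projection onto the column space
of `X̃_J` (`IsLavaSolution.fit_eq`). There are finitely many pairs `(J, s)`, and for each of them
the set where the continuous map `f` equals the corresponding affine map is closed. Almost every
point of such a set is a density point, and there the derivative of `f` has to be the linear part of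
the affine map (`ae_differentiableAt_and_fderiv_eq`). So no uniqueness or local constancy of the
active set is needed: for almost every `y` and whichever minimiser is selected,
`div f(y) = tr(P + K^{1/2} Π_J K^{1/2}) = rank(X̃_J) + tr(K̃_J P)`, where the last step uses
`K = I - P` and that the trace of a projection is its rank (`trace_activeJacobian`).

It remains to prove Stein's lemma for Lipschitz maps,
`E⟨Y - m, f(Y)⟩ = σ² E[div f(Y)]` (`integral_inner_sub_eq_integral_divergence`). The Gaussian
density is identified by its characteristic function, and `E[g(Y + t v)]` is differentiated at
`t = 0` in two ways, on `g` and, after a translation, on the density. Unbiasedness of the risk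
estimate follows by expanding a square (`integral_steinSURE`).
-/

namespace Lava

/-! ### The pseudo-inverse projection onto a column space -/

section ColumnSpace

variable {m k : Type*} [Fintype m] [Fintype k]

/-- The matrix `C (C'C)⁻ C'` of the orthogonal projection onto the column space of `C`. -/
noncomputable def colProj (C : Matrix m k ℝ) : Matrix m m ℝ :=
  C * pinv (Cᵀ * C) * Cᵀ

/-- `(C'C)⁻` inverts `C'C` on its range, and `C` has the same null space as `C'C`. -/
theorem colProj_mul_self (C : Matrix m k ℝ) : colProj C * C = C := by
  classical
  have h := (pinv_spec (Cᵀ * C)).mul_mul_left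
  have h0 : C * (pinv (Cᵀ * C) * (Cᵀ * C) - 1) = 0 := by
    rw [← Matrix.conjTranspose_mul_self_eq_zero, Matrix.conjTranspose_eq_transpose_of_trivial,
      Matrix.transpose_mul, Matrix.mul_assoc, ← Matrix.mul_assoc Cᵀ C, Matrix.mul_sub (Cᵀ * C),
      ← Matrix.mul_assoc (Cᵀ * C), h, Matrix.mul_one, sub_self, Matrix.mul_zero]
  rw [Matrix.mul_sub, Matrix.mul_one, sub_eq_zero] at h0
  rw [colProj, Matrix.mul_assoc, Matrix.mul_assoc, h0]

theorem colProj_mul_colProj (C : Matrix m k ℝ) : colProj C * colProj C = colProj C := by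
  nth_rw 2 [colProj]
  rw [← Matrix.mul_assoc, ← Matrix.mul_assoc, colProj_mul_self, colProj]

theorem trace_eq_rank_of_isIdempotentElem [DecidableEq m] {A : Matrix m m ℝ} (h : A * A = A) :
    A.trace = A.rank := by
  have h1 : IsIdempotentElem (Matrix.toLin' A) := by
    rw [IsIdempotentElem, Module.End.mul_eq_comp, ← Matrix.toLin'_mul, h]
  have h2 := (LinearMap.isProj_range_iff_isIdempotentElem _).2 h1
  rw [← Matrix.trace_toLin'_eq, h2.trace, Matrix.rank, Matrix.toLin'_apply']

theorem trace_colProj (C : Matrix m k ℝ) : (colProj C).trace = C.rank := by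
  classical
  rw [trace_eq_rank_of_isIdempotentElem (colProj_mul_colProj C)]
  congr 1
  apply le_antisymm
  · rw [colProj, Matrix.mul_assoc]
    exact Matrix.rank_mul_le_left _ _
  · conv_lhs => rw [← colProj_mul_self C]
    exact Matrix.rank_mul_le_left _ _

end ColumnSpace

/-! ### The ridge residual matrix and the Jacobian of the lava fit -/

section Ridge

variable {n p : ℕ} (X : Matrix (Fin n) (Fin p) ℝ) (lam₂ : ℝ)

theorem ridgeGram_transpose : (ridgeGram X lam₂)ᵀ = ridgeGram X lam₂ := by
  simp [ridgeGram, Matrix.transpose_add, Matrix.transpose_mul]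

variable {X lam₂}

/-- With `B = (X'X + n lam₂ I)⁻¹ X'` one has `K = (I - X B)'(I - X B) + n lam₂ B'B`. -/
theorem ridgeK_posSemidef (hlam₂ : 0 ≤ lam₂) (hgram : IsUnit (ridgeGram X lam₂)) :
    (ridgeK X lam₂).PosSemidef := by
  set B : Matrix (Fin p) (Fin n) ℝ := (ridgeGram X lam₂)⁻¹ * Xᵀ with hB
  have hdet : IsUnit (ridgeGram X lam₂).det := (Matrix.isUnit_iff_isUnit_det _).1 hgram
  have hGB : ridgeGram X lam₂ * B = Xᵀ := by
    rw [hB, ← Matrix.mul_assoc, Matrix.mul_nonsing_inv _ hdet, Matrix.one_mul]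
  have hBX : Bᵀ * Xᵀ = X * B := by
    rw [hB, Matrix.transpose_mul, Matrix.transpose_transpose, Matrix.transpose_nonsing_inv,
      ridgeGram_transpose, Matrix.mul_assoc]
  have hGB' : Bᵀ * (Xᵀ * X * B + ((n : ℝ) * lam₂) • B) = X * B := by
    have h : Xᵀ * X * B + ((n : ℝ) * lam₂) • B = Xᵀ := by
      simpa [ridgeGram, Matrix.add_mul] using hGB
    rw [h, hBX]
  have hK : ridgeK X lam₂
      = (1 - X * B)ᵀ * (1 - X * B) + ((n : ℝ) * lam₂) • (Bᵀ * B) := by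
    have e : ridgeK X lam₂ = 1 - X * B := by
      rw [ridgeK, ridgeP, hB, Matrix.mul_assoc]
    rw [e, Matrix.transpose_sub, Matrix.transpose_one, Matrix.transpose_mul, hBX, Matrix.sub_mul,
      Matrix.one_mul]
    rw [Matrix.mul_add, Matrix.mul_smul] at hGB'
    have h2 : X * B * (1 - X * B) = ((n : ℝ) * lam₂) • (Bᵀ * B) := by
      rw [Matrix.mul_sub, Matrix.mul_one, sub_eq_iff_eq_add]
      conv_lhs => rw [← hGB']
      rw [add_comm]
      simp only [Matrix.mul_assoc]
      rw [← Matrix.mul_assoc Bᵀ Xᵀ, hBX, Matrix.mul_assoc X B]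
    rw [h2, sub_add_cancel]
  rw [hK]
  have h1 := Matrix.posSemidef_conjTranspose_mul_self (1 - X * B)
  have h2 := Matrix.posSemidef_conjTranspose_mul_self B
  rw [Matrix.conjTranspose_eq_transpose_of_trivial] at h1 h2
  exact h1.add (h2.smul (by positivity))

variable (X lam₂) in
theorem sqrt_ridgeK_transpose : (CFC.sqrt (ridgeK X lam₂))ᵀ = CFC.sqrt (ridgeK X lam₂) := by
  have h : IsSelfAdjoint (CFC.sqrt (ridgeK X lam₂)) := (CFC.sqrt_nonneg _).isSelfAdjoint
  rw [IsSelfAdjoint, Matrix.star_eq_conjTranspose,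
    Matrix.conjTranspose_eq_transpose_of_trivial] at h
  exact h

theorem sqrt_ridgeK_mul_self (hlam₂ : 0 ≤ lam₂) (hgram : IsUnit (ridgeGram X lam₂)) :
    CFC.sqrt (ridgeK X lam₂) * CFC.sqrt (ridgeK X lam₂) = ridgeK X lam₂ :=
  CFC.sqrt_mul_sqrt_self _ (ridgeK_posSemidef hlam₂ hgram).nonneg

variable (X lam₂) in
/-- The matrix `P + K^{1/2} Π_J K^{1/2}`, with `Π_J` the projection onto the column space of
`X̃_J`: the Jacobian of the lava fit on the region of data where the active set is `J`. -/
noncomputable def activeJacobian (J : Finset (Fin p)) : Matrix (Fin n) (Fin n) ℝ :=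
  ridgeP X lam₂ + CFC.sqrt (ridgeK X lam₂) * colProj (columns (tildeX X lam₂) J)
    * CFC.sqrt (ridgeK X lam₂)

/-- Cyclicity of the trace moves the two factors `K^{1/2}` together, and `K = I - P`. -/
theorem trace_activeJacobian (hlam₂ : 0 ≤ lam₂) (hgram : IsUnit (ridgeGram X lam₂))
    (δ : EuclideanSpace ℝ (Fin p)) :
    (activeJacobian X lam₂ (activeSet δ)).trace = dfTerm X lam₂ δ := by
  rw [activeJacobian, dfTerm, ← trace_colProj, residualProj, ← colProj, Matrix.trace_add,
    Matrix.trace_mul_cycle, sqrt_ridgeK_mul_self hlam₂ hgram, Matrix.trace_mul_comm, ridgeK,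
    Matrix.mul_sub, Matrix.sub_mul, Matrix.mul_one, Matrix.one_mul, Matrix.trace_sub,
    Matrix.trace_sub]
  ring

end Ridge

/-! ### Optimality conditions for the lava criterion -/

section Optimality

variable {n p : ℕ} {X : Matrix (Fin n) (Fin p) ℝ}

theorem apply_add (v w : EuclideanSpace ℝ (Fin p)) :
    apply X (v + w) = apply X v + apply X w := by
  simp [apply, Matrix.mulVec_add]

theorem apply_smul (c : ℝ) (v : EuclideanSpace ℝ (Fin p)) :
    apply X (c • v) = c • apply X v := by
  simp [apply, Matrix.mulVec_smul]

theorem inner_apply_right (u : EuclideanSpace ℝ (Fin n)) (v : EuclideanSpace ℝ (Fin p)) :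
    inner ℝ u (apply X v) = v.ofLp ⬝ᵥ (Xᵀ *ᵥ u.ofLp) := by
  rw [apply, EuclideanSpace.inner_eq_star_dotProduct, star_trivial, Matrix.dotProduct_mulVec,
    Matrix.vecMul_transpose]

theorem nonneg_of_forall_mul_add_sq_mul_nonneg {a c : ℝ}
    (h : ∀ s : ℝ, 0 < s → s ≤ 1 → 0 ≤ s * a + s ^ 2 * c) : 0 ≤ a := by
  have hlim : Filter.Tendsto (fun s : ℝ => a + s * c) (nhdsWithin 0 (Set.Ioi 0)) (nhds a) := by
    have : Filter.Tendsto (fun s : ℝ => a + s * c) (nhds 0) (nhds (a + 0 * c)) :=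
      Continuous.tendsto (by fun_prop) 0
    rw [zero_mul, add_zero] at this
    exact this.mono_left nhdsWithin_le_nhds
  refine ge_of_tendsto hlim ?_
  filter_upwards [Ioc_mem_nhdsGT (zero_lt_one' ℝ)] with s hs
  have h1 : 0 ≤ s * (a + s * c) := by linarith [h s hs.1 hs.2, sq s, mul_assoc s s c]
  exact nonneg_of_mul_nonneg_right h1 hs.1

variable {lam₁ lam₂ : ℝ} {y y' : EuclideanSpace ℝ (Fin n)}
  {β δ β' δ' : EuclideanSpace ℝ (Fin p)}

variable (lam₁ lam₂) in
/-- The lava penalty `lam₂ ‖β‖₂² + lam₁ ‖δ‖₁`. -/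
noncomputable def penalty (β δ : EuclideanSpace ℝ (Fin p)) : ℝ :=
  lam₂ * ‖β‖ ^ 2 + lam₁ * ∑ j, |δ j|

theorem penalty_add_smul_le (hlam₁ : 0 ≤ lam₁) (hlam₂ : 0 ≤ lam₂)
    (β δ b d : EuclideanSpace ℝ (Fin p)) {s : ℝ} (hs : 0 < s) (hs1 : s ≤ 1) :
    penalty lam₁ lam₂ (β + s • (b - β)) (δ + s • (d - δ))
      ≤ penalty lam₁ lam₂ β δ + s * (penalty lam₁ lam₂ b d - penalty lam₁ lam₂ β δ) := by
  have h1 : ‖β + s • (b - β)‖ ^ 2 ≤ ‖β‖ ^ 2 + s * (‖b‖ ^ 2 - ‖β‖ ^ 2) := by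
    have e := norm_add_sq_real β (s • (b - β))
    have e2 := norm_add_sq_real β (b - β)
    rw [add_sub_cancel] at e2
    rw [real_inner_smul_right, norm_smul, mul_pow, Real.norm_eq_abs, sq_abs] at e
    rw [e, e2]
    nlinarith [mul_nonneg (mul_nonneg hs.le (sub_nonneg.2 hs1)) (sq_nonneg ‖b - β‖)]
  have h2 : ∑ j, |(δ + s • (d - δ)) j| ≤ ∑ j, |δ j| + s * (∑ j, |d j| - ∑ j, |δ j|) := by
    have e : ∑ j, |δ j| + s * (∑ j, |d j| - ∑ j, |δ j|)
        = ∑ j, (|δ j| + s * (|d j| - |δ j|)) := by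
      rw [Finset.sum_add_distrib, ← Finset.mul_sum, Finset.sum_sub_distrib]
    rw [e]
    refine Finset.sum_le_sum fun j _ => ?_
    have : (δ + s • (d - δ)) j = (1 - s) * δ j + s * d j := by
      simp only [PiLp.add_apply, PiLp.smul_apply, PiLp.sub_apply, smul_eq_mul]; ring
    rw [this]
    refine (abs_add_le _ _).trans (le_of_eq ?_)
    rw [abs_mul, abs_mul, abs_of_nonneg (sub_nonneg.2 hs1), abs_of_pos hs]
    ring
  unfold penalty
  nlinarith [mul_le_mul_of_nonneg_left h1 hlam₂, mul_le_mul_of_nonneg_left h2 hlam₁]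

/-- Variational inequality at a minimiser of squared loss plus convex penalty, from comparison with
the points of the segment towards `(b, d)` close to the minimiser. -/
theorem IsLavaSolution.inner_le (hlam₁ : 0 ≤ lam₁) (hlam₂ : 0 ≤ lam₂)
    (h : IsLavaSolution X lam₁ lam₂ y β δ) (b d : EuclideanSpace ℝ (Fin p)) :
    2 / (n : ℝ) * inner ℝ (y - apply X (β + δ)) (apply X (b + d) - apply X (β + δ))
      ≤ penalty lam₁ lam₂ b d - penalty lam₁ lam₂ β δ := by
  rw [← sub_nonneg]
  set r := y - apply X (β + δ) with hr
  set v := apply X (b + d) - apply X (β + δ) with hv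
  refine nonneg_of_forall_mul_add_sq_mul_nonneg (c := 1 / (n : ℝ) * ‖v‖ ^ 2) fun s hs hs1 => ?_
  have h1 := h (β + s • (b - β)) (δ + s • (d - δ))
  have e : y - apply X (β + s • (b - β) + (δ + s • (d - δ))) = r - s • v := by
    have : β + s • (b - β) + (δ + s • (d - δ))
        = (β + δ) + s • ((b + d) + (-1 : ℝ) • (β + δ)) := by module
    rw [this, apply_add, apply_smul, apply_add (X := X) (b + d), apply_smul, hr, hv]
    module
  have h2 := penalty_add_smul_le hlam₁ hlam₂ β δ b d hs hs1
  unfold objective at h1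
  unfold penalty at h2 ⊢
  rw [e, ← hr, norm_sub_sq_real r, real_inner_smul_right, norm_smul, mul_pow, Real.norm_eq_abs,
    sq_abs] at h1
  have e3 : 2 / (n : ℝ) = 2 * (1 / n) := by ring
  rw [e3]
  nlinarith

/-- The fit is a proximal map of a convex function, hence nonexpansive: adding the variational
inequalities at the two minimisers gives `‖u - u'‖² ≤ ⟨y - y', u - u'⟩` for the fits `u`, `u'`. -/
theorem IsLavaSolution.norm_sub_le (hn : 0 < n) (hlam₁ : 0 ≤ lam₁) (hlam₂ : 0 ≤ lam₂)
    (h : IsLavaSolution X lam₁ lam₂ y β δ) (h' : IsLavaSolution X lam₁ lam₂ y' β' δ') :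
    ‖apply X (β + δ) - apply X (β' + δ')‖ ≤ ‖y - y'‖ := by
  have h1 := h.inner_le hlam₁ hlam₂ β' δ'
  have h2 := h'.inner_le hlam₁ hlam₂ β δ
  set u := apply X (β + δ)
  set u' := apply X (β' + δ')
  have hn' : (0 : ℝ) < 2 / n := by positivity
  have h3 : inner ℝ (y - u) (u' - u) + inner ℝ (y' - u') (u - u') ≤ 0 := by
    by_contra! hc
    nlinarith [mul_pos hn' hc]
  have h4 : ‖u - u'‖ ^ 2 ≤ inner ℝ (y - y') (u - u') := by
    rw [← real_inner_self_eq_norm_sq]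
    simp only [inner_sub_left, inner_sub_right] at h3 ⊢
    linarith
  have h5 := h4.trans (real_inner_le_norm _ _)
  by_contra! hc
  nlinarith [norm_nonneg (u - u'), norm_nonneg (y - y')]

theorem lipschitzWith_fit (hn : 0 < n) (hlam₁ : 0 ≤ lam₁) (hlam₂ : 0 ≤ lam₂)
    {βhat δhat : EuclideanSpace ℝ (Fin n) → EuclideanSpace ℝ (Fin p)}
    (hlava : ∀ y, IsLavaSolution X lam₁ lam₂ y (βhat y) (δhat y)) :
    LipschitzWith 1 fun y => apply X (βhat y + δhat y) :=
  LipschitzWith.of_dist_le_mul fun y y' => by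
    simpa [dist_eq_norm] using (hlava y).norm_sub_le hn hlam₁ hlam₂ (hlava y')

/-- Stationarity in the dense part `β`: `X'(y - X(β + δ)) = n lam₂ β`. -/
theorem IsLavaSolution.transpose_mulVec_residual (hn : 0 < n) (hlam₁ : 0 ≤ lam₁)
    (hlam₂ : 0 ≤ lam₂) (h : IsLavaSolution X lam₁ lam₂ y β δ) :
    Xᵀ *ᵥ (y - apply X (β + δ)).ofLp = ((n : ℝ) * lam₂) • β.ofLp := by
  have hn' : (0 : ℝ) < n := by exact_mod_cast hn
  set r := y - apply X (β + δ) with hr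
  have key : ∀ v : EuclideanSpace ℝ (Fin p),
      0 ≤ 2 * lam₂ * inner ℝ β v - 2 / (n : ℝ) * inner ℝ r (apply X v) := by
    intro v
    refine nonneg_of_forall_mul_add_sq_mul_nonneg (c := lam₂ * ‖v‖ ^ 2) fun s hs hs1 => ?_
    have h1 := h.inner_le hlam₁ hlam₂ (β + s • v) δ
    have e : apply X (β + s • v + δ) - apply X (β + δ) = s • apply X v := by
      rw [add_right_comm, apply_add, apply_smul, add_sub_cancel_left]
    rw [e, ← hr, real_inner_smul_right, penalty, penalty, norm_add_sq_real,
      real_inner_smul_right, norm_smul, mul_pow, Real.norm_eq_abs, sq_abs] at h1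
    nlinarith
  have key2 : ∀ v : EuclideanSpace ℝ (Fin p),
      inner ℝ r (apply X v) = (n : ℝ) * lam₂ * inner ℝ β v := by
    intro v
    have h1 := key v
    have h2 := key ((-1 : ℝ) • v)
    rw [apply_smul, real_inner_smul_right, real_inner_smul_right] at h2
    have h3 : 2 / (n : ℝ) * inner ℝ r (apply X v) = 2 * lam₂ * inner ℝ β v := by linarith
    field_simp at h3
    linarith
  ext j
  have h1 := key2 (EuclideanSpace.single j 1)
  rw [inner_apply_right] at h1
  simpa [EuclideanSpace.inner_single_right] using h1

/-- Stationarity in an active coordinate of the sparse part `δ`, obtained by comparing `δ` with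
the two vectors in which the coordinate `δ j` is doubled or deleted. -/
theorem IsLavaSolution.transpose_mulVec_residual_apply (hn : 0 < n) (hlam₁ : 0 ≤ lam₁)
    (hlam₂ : 0 ≤ lam₂) (h : IsLavaSolution X lam₁ lam₂ y β δ) {j : Fin p} (hj : δ j ≠ 0) :
    (Xᵀ *ᵥ (y - apply X (β + δ)).ofLp) j
      = (n : ℝ) * lam₁ / 2 * (SignType.sign (δ j) : ℝ) := by
  have hn' : (0 : ℝ) < n := by exact_mod_cast hn
  set r := y - apply X (β + δ) with hr
  have key : ∀ t : ℝ, 2 / (n : ℝ) * (t * (Xᵀ *ᵥ r.ofLp) j) ≤ lam₁ * (|δ j + t| - |δ j|) := by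
    intro t
    have h1 := h.inner_le hlam₁ hlam₂ β (δ + EuclideanSpace.single j t)
    have e : apply X (β + (δ + EuclideanSpace.single j t)) - apply X (β + δ)
        = apply X (EuclideanSpace.single j t) := by
      rw [← add_assoc, apply_add, add_sub_cancel_left]
    have e2 : ∑ i, |(δ + EuclideanSpace.single j t) i| - ∑ i, |δ i| = |δ j + t| - |δ j| := by
      rw [← Finset.sum_sub_distrib, Finset.sum_eq_single j]
      · simp
      · intro i _ hi
        simp [hi]
      · simp
    rw [e, ← hr, inner_apply_right] at h1
    simp only [PiLp.ofLp_single, single_dotProduct] at h1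
    refine h1.trans (le_of_eq ?_)
    rw [← e2, penalty, penalty]
    ring
  have h1 := key (δ j)
  have h2 := key (-δ j)
  rw [add_neg_cancel, abs_zero] at h2
  rw [← two_mul, abs_mul, abs_two] at h1
  have h3 : 2 / (n : ℝ) * (δ j * (Xᵀ *ᵥ r.ofLp) j) = lam₁ * |δ j| := by linarith
  rw [← sign_mul_self (δ j)] at h3
  field_simp at h3
  linarith

end Optimality

/-! ### The lava fit as a piecewise affine function of the data -/

section PiecewiseAffine

variable {n p : ℕ} {X : Matrix (Fin n) (Fin p) ℝ} {lam₁ lam₂ : ℝ}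
  {y : EuclideanSpace ℝ (Fin n)} {β δ : EuclideanSpace ℝ (Fin p)}

/-- The dense part is the ridge fit to the residual of the sparse part: `X β = P (y - X δ)`. -/
theorem apply_beta_eq (hn : 0 < n) (hlam₁ : 0 ≤ lam₁)
    (hlam₂ : 0 ≤ lam₂) (hgram : IsUnit (ridgeGram X lam₂))
    (h : IsLavaSolution X lam₁ lam₂ y β δ) :
    X *ᵥ β.ofLp = ridgeP X lam₂ *ᵥ (y.ofLp - X *ᵥ δ.ofLp) := by
  have h1 := h.transpose_mulVec_residual hn hlam₁ hlam₂
  have hdet : IsUnit (ridgeGram X lam₂).det := (Matrix.isUnit_iff_isUnit_det _).1 hgram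
  have h2 : ridgeGram X lam₂ *ᵥ β.ofLp = Xᵀ *ᵥ (y.ofLp - X *ᵥ δ.ofLp) := by
    rw [ridgeGram, Matrix.add_mulVec, Matrix.smul_mulVec, Matrix.one_mulVec, ← h1]
    simp only [apply, WithLp.ofLp_sub, WithLp.ofLp_add, Matrix.mulVec_add, Matrix.mulVec_sub,
      ← Matrix.mulVec_mulVec]
    abel
  rw [ridgeP, ← Matrix.mulVec_mulVec, ← h2, ← Matrix.mulVec_mulVec, Matrix.mulVec_mulVec β.ofLp,
    Matrix.nonsing_inv_mul _ hdet, Matrix.one_mulVec]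

theorem columns_mulVec_activeSet (A : Matrix (Fin n) (Fin p) ℝ) (δ : EuclideanSpace ℝ (Fin p)) :
    columns A (activeSet δ) *ᵥ (fun j => δ j) = A *ᵥ δ.ofLp := by
  ext i
  simp only [Matrix.mulVec, dotProduct, columns, Matrix.submatrix_apply, id]
  rw [Finset.sum_coe_sort (activeSet δ) fun j => A i j * δ j, activeSet, Finset.sum_filter_of_ne]
  intro j _ hj h0
  simp [h0] at hj

variable (X lam₁ lam₂) in
/-- The constant term of the affine map with which the lava fit coincides on the region of data
where the active set is `J` and the signs of the active coefficients are `s`. -/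
noncomputable def activeOffset (J : Finset (Fin p)) (s : Fin p → SignType) :
    EuclideanSpace ℝ (Fin n) :=
  WithLp.toLp 2 (-(CFC.sqrt (ridgeK X lam₂) *ᵥ (columns (tildeX X lam₂) J *ᵥ
    (pinv ((columns (tildeX X lam₂) J)ᵀ * columns (tildeX X lam₂) J) *ᵥ
      fun j => (n : ℝ) * lam₁ / 2 * (s j : ℝ)))))

/-- Given its active set and signs, the fit is an affine function of the data. With
`C = X̃_J`, the dense part gives `X(β + δ) = P y + K X δ` and the stationarity conditions of the
sparse part read `C'(K^{1/2} y - C δ_J) = (n lam₁ / 2) s`; multiplying by `C (C'C)⁻` determines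
`C δ_J = X̃ δ`, since `C (C'C)⁻ C'` fixes the columns of `C`. -/
theorem IsLavaSolution.fit_eq (hn : 0 < n) (hlam₁ : 0 ≤ lam₁)
    (hlam₂ : 0 ≤ lam₂) (hgram : IsUnit (ridgeGram X lam₂))
    (h : IsLavaSolution X lam₁ lam₂ y β δ) :
    apply X (β + δ) = Matrix.toEuclideanCLM (𝕜 := ℝ) (activeJacobian X lam₂ (activeSet δ)) y
      + activeOffset X lam₁ lam₂ (activeSet δ) (fun j => SignType.sign (δ j)) := by
  set S := CFC.sqrt (ridgeK X lam₂) with hS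
  set C := columns (tildeX X lam₂) (activeSet δ) with hC
  have hSS : S * S = ridgeK X lam₂ := sqrt_ridgeK_mul_self hlam₂ hgram
  have hST : Sᵀ = S := sqrt_ridgeK_transpose X lam₂
  have hfit : (apply X (β + δ)).ofLp
      = ridgeP X lam₂ *ᵥ y.ofLp + ridgeK X lam₂ *ᵥ (X *ᵥ δ.ofLp) := by
    simp only [apply, WithLp.ofLp_add, Matrix.mulVec_add]
    rw [apply_beta_eq hn hlam₁ hlam₂ hgram h, ridgeK, Matrix.mulVec_sub, Matrix.sub_mulVec,
      Matrix.one_mulVec]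
    abel
  have hres : (y - apply X (β + δ)).ofLp = S *ᵥ (S *ᵥ (y.ofLp - X *ᵥ δ.ofLp)) := by
    rw [WithLp.ofLp_sub, hfit, Matrix.mulVec_mulVec _ S S, hSS, Matrix.mulVec_sub, ridgeK]
    simp only [Matrix.sub_mulVec, Matrix.one_mulVec]
    abel
  have hCδ : C *ᵥ (fun j => δ j) = S *ᵥ (X *ᵥ δ.ofLp) := by
    rw [hC, columns_mulVec_activeSet, tildeX, ← hS, Matrix.mulVec_mulVec]
  have hkkt : Cᵀ *ᵥ (S *ᵥ y.ofLp - C *ᵥ (fun j => δ j))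
      = fun j : activeSet δ => (n : ℝ) * lam₁ / 2 * (SignType.sign (δ j) : ℝ) := by
    ext j
    have hj : δ j ≠ 0 := (Finset.mem_filter.1 j.2).2
    rw [← h.transpose_mulVec_residual_apply hn hlam₁ hlam₂ hj, hres, hCδ, ← Matrix.mulVec_sub]
    have e : Xᵀ *ᵥ (S *ᵥ (S *ᵥ (y.ofLp - X *ᵥ δ.ofLp)))
        = (tildeX X lam₂)ᵀ *ᵥ (S *ᵥ (y.ofLp - X *ᵥ δ.ofLp)) := by
      rw [tildeX, Matrix.transpose_mul, ← hS, hST, Matrix.mulVec_mulVec _ Xᵀ S]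
    rw [e]
    rfl
  have hproj : C *ᵥ (fun j => δ j) = colProj C *ᵥ (S *ᵥ y.ofLp) - C *ᵥ (pinv (Cᵀ * C) *ᵥ
      fun j : activeSet δ => (n : ℝ) * lam₁ / 2 * (SignType.sign (δ j) : ℝ)) := by
    have hdef (w : Fin n → ℝ) : C *ᵥ (pinv (Cᵀ * C) *ᵥ (Cᵀ *ᵥ w)) = colProj C *ᵥ w := by
      rw [Matrix.mulVec_mulVec, Matrix.mulVec_mulVec, colProj]
    have e : colProj C *ᵥ (C *ᵥ fun j : activeSet δ => δ j) = C *ᵥ fun j => δ j := by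
      rw [Matrix.mulVec_mulVec, colProj_mul_self]
    rw [← hkkt, hdef, Matrix.mulVec_sub, e]
    abel
  apply WithLp.ofLp_injective
  rw [hfit, ← hSS, ← Matrix.mulVec_mulVec, ← hCδ, hproj, WithLp.ofLp_add,
    Matrix.ofLp_toEuclideanCLM, activeJacobian, activeOffset, ← hS, ← hC]
  simp only [Matrix.add_mulVec, Matrix.mulVec_sub, ← Matrix.mulVec_mulVec]
  abel

end PiecewiseAffine

/-! ### Derivatives of Lipschitz maps that are pieced together from affine maps -/

/-- If a Lipschitz map coincides at each point with one of countably many affine maps, then at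
almost every point its derivative is the linear part of *every* affine map it coincides with there:
on the closed set where the map is equal to a fixed affine map, almost every point is a density
point. -/
theorem ae_differentiableAt_and_fderiv_eq {E : Type*} [NormedAddCommGroup E] [NormedSpace ℝ E]
    [FiniteDimensional ℝ E] [MeasurableSpace E] [BorelSpace E] (μ : Measure E)
    [μ.IsAddHaarMeasure] {C : NNReal} {f : E → E} (hf : LipschitzWith C f) {ι : Type*} [Countable ι]
    (A : ι → E →L[ℝ] E) (a : ι → E) :
    ∀ᵐ y ∂μ, DifferentiableAt ℝ f y ∧ ∀ i, f y = A i y + a i → fderiv ℝ f y = A i := by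
  have hdiff := hf.ae_differentiableAt (μ := μ)
  refine hdiff.and (ae_all_iff.2 fun i => ?_)
  set s := {y | f y = A i y + a i} with hs
  have hclosed : IsClosed s :=
    isClosed_eq hf.continuous ((A i).continuous.add continuous_const)
  set t := {y | DifferentiableAt ℝ f y} with ht
  have hmeas : MeasurableSet (s ∩ t) :=
    hclosed.measurableSet.inter (measurableSet_of_differentiableAt ℝ f)
  have happ : ApproximatesLinearOn f (A i) (s ∩ t) 0 := by
    intro x hx y hy
    have h1 : f x = A i x + a i := hx.1
    have h2 : f y = A i y + a i := hy.1
    simp [h1, h2]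
  have h := happ.norm_fderiv_sub_le μ hmeas (fderiv ℝ f)
    fun x hx => (DifferentiableAt.hasFDerivAt hx.2).hasFDerivWithinAt
  rw [ae_restrict_iff' hmeas] at h
  filter_upwards [h, hdiff] with y hy hd hys
  have := hy ⟨hys, hd⟩
  rwa [nonpos_iff_eq_zero, nnnorm_eq_zero, sub_eq_zero] at this

theorem divergence_eq_trace {n : ℕ} {f : EuclideanSpace ℝ (Fin n) → EuclideanSpace ℝ (Fin n)}
    {y : EuclideanSpace ℝ (Fin n)} {A : Matrix (Fin n) (Fin n) ℝ}
    (h : fderiv ℝ f y = Matrix.toEuclideanCLM (𝕜 := ℝ) A) : divergence f y = A.trace := by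
  rw [divergence, h, Matrix.trace]
  refine Finset.sum_congr rfl fun i _ => ?_
  simp

/-- For almost every `y`, the lava fit is differentiable at `y` with divergence
`rank(X̃_J) + tr(K̃_J P)`, where `J` is the active set of the selected solution. -/
theorem ae_differentiableAt_and_divergence_eq {n p : ℕ} (hn : 0 < n)
    {X : Matrix (Fin n) (Fin p) ℝ} {lam₁ lam₂ : ℝ} (hlam₁ : 0 ≤ lam₁) (hlam₂ : 0 ≤ lam₂)
    (hgram : IsUnit (ridgeGram X lam₂))
    {βhat δhat : EuclideanSpace ℝ (Fin n) → EuclideanSpace ℝ (Fin p)}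
    (hlava : ∀ y, IsLavaSolution X lam₁ lam₂ y (βhat y) (δhat y)) :
    ∀ᵐ y, DifferentiableAt ℝ (fun y => apply X (βhat y + δhat y)) y ∧
      divergence (fun y => apply X (βhat y + δhat y)) y = dfTerm X lam₂ (δhat y) := by
  have h := ae_differentiableAt_and_fderiv_eq volume (lipschitzWith_fit hn hlam₁ hlam₂ hlava)
    (ι := Finset (Fin p) × (Fin p → SignType))
    (fun i => Matrix.toEuclideanCLM (𝕜 := ℝ) (activeJacobian X lam₂ i.1))
    (fun i => activeOffset X lam₁ lam₂ i.1 i.2)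
  filter_upwards [h] with y hy
  refine ⟨hy.1, ?_⟩
  have := hy.2 (activeSet (δhat y), fun j => SignType.sign (δhat y j))
    ((hlava y).fit_eq hn hlam₁ hlam₂ hgram)
  rw [divergence_eq_trace this, trace_activeJacobian hlam₂ hgram]

/-! ### Density of the isotropic Gaussian measure -/

section Gaussian

variable {n : ℕ} (m : EuclideanSpace ℝ (Fin n)) {σ : ℝ}

/-- The unnormalised isotropic Gaussian density `exp (-‖x - m‖² / (2σ²))`. -/
noncomputable def gaussKernel (m : EuclideanSpace ℝ (Fin n)) (σ : ℝ)
    (x : EuclideanSpace ℝ (Fin n)) : ℝ :=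
  Real.exp (-(1 / (2 * σ ^ 2)) * ‖x - m‖ ^ 2)

theorem continuous_gaussKernel (m : EuclideanSpace ℝ (Fin n)) (σ : ℝ) :
    Continuous (gaussKernel m σ) := by
  unfold gaussKernel; fun_prop

theorem integrable_exp_neg_mul_sq_norm {b : ℝ} (hb : 0 < b) :
    Integrable fun x : EuclideanSpace ℝ (Fin n) => Real.exp (-b * ‖x‖ ^ 2) := by
  have h := GaussianFourier.integrable_cexp_neg_mul_sq_norm_add (V := EuclideanSpace ℝ (Fin n))
    (b := (b : ℂ)) (by simpa using hb) 0 0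
  refine (h.norm).congr (Filter.Eventually.of_forall fun x => ?_)
  simp only [Complex.norm_exp]
  congr 1
  have : (-(b : ℂ) * (‖x‖ : ℂ) ^ 2 + 0 * ((inner ℝ 0 x : ℝ) : ℂ))
    = ((-b * ‖x‖ ^ 2 : ℝ) : ℂ) := by push_cast; ring
  rw [this, Complex.ofReal_re]

theorem integrable_gaussKernel (hσ : 0 < σ) : Integrable (gaussKernel m σ) :=
  (integrable_exp_neg_mul_sq_norm (n := n) (b := 1 / (2 * σ ^ 2)) (by positivity)).comp_sub_right m

theorem integral_gaussKernel_pos (hσ : 0 < σ) : 0 < ∫ x, gaussKernel m σ x :=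
  integral_exp_pos (integrable_gaussKernel m hσ)

/-- Fourier transform of the Gaussian kernel. -/
theorem integral_gaussKernel_mul_cexp (hσ : 0 < σ) (t : EuclideanSpace ℝ (Fin n)) :
    ∫ x, (gaussKernel m σ x : ℂ) * Complex.exp ((inner ℝ x t : ℝ) * Complex.I)
      = (∫ x, gaussKernel m σ x : ℝ)
        * Complex.exp ((inner ℝ t m : ℝ) * Complex.I - (σ ^ 2 * ‖t‖ ^ 2 : ℝ) / 2) := by
  have hb : 0 < (((1 / (2 * σ ^ 2) : ℝ) : ℂ)).re := by
    rw [Complex.ofReal_re]; positivity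
  have hZ : ((∫ x, gaussKernel m σ x : ℝ) : ℂ)
      = (Real.pi / ((1 / (2 * σ ^ 2) : ℝ) : ℂ))
          ^ (Module.finrank ℝ (EuclideanSpace ℝ (Fin n)) / 2 : ℂ) := by
    rw [← GaussianFourier.integral_cexp_neg_mul_sq_norm hb, ← integral_complex_ofReal]
    refine Eq.trans ?_ (integral_sub_right_eq_self _ m)
    congr 1
    ext x
    rw [gaussKernel]
    push_cast
    rfl
  have h := GaussianFourier.integral_cexp_neg_mul_sq_norm_add hb Complex.I t
  rw [← integral_sub_right_eq_self _ m] at h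
  have e : ∀ x : EuclideanSpace ℝ (Fin n),
      (gaussKernel m σ x : ℂ) * Complex.exp ((inner ℝ x t : ℝ) * Complex.I)
        = Complex.exp ((inner ℝ t m : ℝ) * Complex.I)
          * Complex.exp (-((1 / (2 * σ ^ 2) : ℝ) : ℂ) * (‖x - m‖ : ℂ) ^ 2
              + Complex.I * (inner ℝ t (x - m) : ℝ)) := by
    intro x
    rw [gaussKernel, Complex.ofReal_exp, ← Complex.exp_add, ← Complex.exp_add, inner_sub_right,
      real_inner_comm x t]
    congr 1
    push_cast
    ring
  simp_rw [e]
  rw [integral_const_mul, h, ← hZ, mul_left_comm, ← Complex.exp_add]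
  congr 2
  have hσ' : (σ : ℂ) ≠ 0 := by exact_mod_cast hσ.ne'
  rw [Complex.I_sq]
  push_cast
  field_simp
  ring

theorem posSemidef_smul_one (σ : ℝ) :
    (σ ^ 2 • (1 : Matrix (Fin n) (Fin n) ℝ)).PosSemidef :=
  Matrix.PosSemidef.one.smul (sq_nonneg σ)

/-- The normalised isotropic Gaussian density. -/
noncomputable def gaussDensity (m : EuclideanSpace ℝ (Fin n)) (σ : ℝ)
    (x : EuclideanSpace ℝ (Fin n)) : ℝ :=
  (∫ z, gaussKernel m σ z)⁻¹ * gaussKernel m σ x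

theorem gaussDensity_nonneg (m : EuclideanSpace ℝ (Fin n)) (σ : ℝ)
    (x : EuclideanSpace ℝ (Fin n)) : 0 ≤ gaussDensity m σ x :=
  mul_nonneg (inv_nonneg.2 (integral_nonneg fun _ => (Real.exp_pos _).le)) (Real.exp_pos _).le

theorem continuous_gaussDensity (m : EuclideanSpace ℝ (Fin n)) (σ : ℝ) :
    Continuous (gaussDensity m σ) :=
  continuous_const.mul (continuous_gaussKernel m σ)

theorem integrable_gaussDensity (hσ : 0 < σ) : Integrable (gaussDensity m σ) :=
  (integrable_gaussKernel m hσ).const_mul _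

/-- The two finite measures have the same characteristic function. The normalising constant
cancels, so its value is not needed. -/
theorem multivariateGaussian_eq_withDensity (hσ : 0 < σ) :
    multivariateGaussian m (σ ^ 2 • (1 : Matrix (Fin n) (Fin n) ℝ))
      = volume.withDensity fun x => ENNReal.ofReal (gaussDensity m σ x) := by
  have hfin : IsFiniteMeasure
      ((volume : Measure (EuclideanSpace ℝ (Fin n))).withDensity
        fun x => ENNReal.ofReal (gaussDensity m σ x)) :=
    isFiniteMeasure_withDensity_ofReal (integrable_gaussDensity m hσ).2
  apply Measure.ext_of_charFun
  ext t
  rw [charFun_multivariateGaussian (posSemidef_smul_one σ), charFun_apply,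
    integral_withDensity_eq_integral_toReal_smul
      (continuous_gaussDensity m σ).measurable.ennreal_ofReal (by simp)]
  have e : ∀ x : EuclideanSpace ℝ (Fin n),
      (ENNReal.ofReal (gaussDensity m σ x)).toReal • Complex.exp ((inner ℝ x t : ℝ) * Complex.I)
        = ((∫ z, gaussKernel m σ z : ℝ) : ℂ)⁻¹ *
          ((gaussKernel m σ x : ℂ) * Complex.exp ((inner ℝ x t : ℝ) * Complex.I)) := by
    intro x
    rw [ENNReal.toReal_ofReal (gaussDensity_nonneg m σ x), gaussDensity, Complex.real_smul]
    push_cast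
    ring
  simp_rw [e]
  have hZ : ((∫ z, gaussKernel m σ z : ℝ) : ℂ) ≠ 0 := by
    exact_mod_cast (integral_gaussKernel_pos m hσ).ne'
  rw [integral_const_mul, integral_gaussKernel_mul_cexp m hσ, inv_mul_cancel_left₀ hZ]
  congr 3
  rw [Matrix.smul_mulVec, Matrix.one_mulVec, dotProduct_smul, smul_eq_mul,
    EuclideanSpace.real_norm_sq_eq]
  simp [dotProduct, sq]

theorem multivariateGaussian_absolutelyContinuous (hσ : 0 < σ) :
    multivariateGaussian m (σ ^ 2 • (1 : Matrix (Fin n) (Fin n) ℝ)) ≪ volume := by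
  rw [multivariateGaussian_eq_withDensity m hσ]
  exact withDensity_absolutelyContinuous _ _

theorem integral_multivariateGaussian (hσ : 0 < σ) (h : EuclideanSpace ℝ (Fin n) → ℝ) :
    ∫ x, h x ∂multivariateGaussian m (σ ^ 2 • (1 : Matrix (Fin n) (Fin n) ℝ))
      = ∫ x, h x * gaussDensity m σ x := by
  rw [multivariateGaussian_eq_withDensity m hσ, integral_withDensity_eq_integral_toReal_smul
      (continuous_gaussDensity m σ).measurable.ennreal_ofReal (by simp)]
  congr 1
  ext x
  rw [ENNReal.toReal_ofReal (gaussDensity_nonneg m σ x), smul_eq_mul, mul_comm]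

end Gaussian

/-! ### Stein's lemma for Lipschitz functions -/

section Stein

variable {n : ℕ} (m : EuclideanSpace ℝ (Fin n)) {σ : ℝ}

theorem integrable_one_add_sq_norm_mul_exp {b : ℝ} (hb : 0 < b) :
    Integrable fun x : EuclideanSpace ℝ (Fin n) => (1 + ‖x‖ ^ 2) * Real.exp (-b * ‖x‖ ^ 2) := by
  have h1 := integrable_exp_neg_mul_sq_norm (n := n) hb
  have h2 : Integrable fun x : EuclideanSpace ℝ (Fin n) => ‖x‖ ^ 2 * Real.exp (-b * ‖x‖ ^ 2) := by
    refine Integrable.mono' ((integrable_exp_neg_mul_sq_norm (n := n) (half_pos hb)).const_mul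
      (2 / b)) (by fun_prop) (Filter.Eventually.of_forall fun x => ?_)
    -- half of the exponent absorbs the polynomial factor, as `s ≤ exp s` for `s = b ‖x‖² / 2`
    have h3 : b / 2 * ‖x‖ ^ 2 ≤ Real.exp (b / 2 * ‖x‖ ^ 2) := by
      linarith [Real.add_one_le_exp (b / 2 * ‖x‖ ^ 2)]
    have h4 : Real.exp (b / 2 * ‖x‖ ^ 2) * Real.exp (-b * ‖x‖ ^ 2)
        = Real.exp (-(b / 2) * ‖x‖ ^ 2) := by
      rw [← Real.exp_add]; congr 1; ring
    rw [Real.norm_of_nonneg (by positivity), ← h4, ← mul_assoc]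
    refine mul_le_mul_of_nonneg_right ?_ (Real.exp_pos _).le
    rw [div_mul_eq_mul_div, le_div_iff₀ hb]
    linarith
  refine (h1.add h2).congr (Filter.Eventually.of_forall fun x => ?_)
  simp only [Pi.add_apply]
  ring

theorem hasDerivAt_gaussDensity_sub_smul (hσ : 0 < σ) (v x : EuclideanSpace ℝ (Fin n)) (t : ℝ) :
    HasDerivAt (fun t : ℝ => gaussDensity m σ (x - t • v))
      ((inner ℝ (x - m) v - t * ‖v‖ ^ 2) / σ ^ 2 * gaussDensity m σ (x - t • v)) t := by
  have e : ∀ s : ℝ, ‖x - s • v - m‖ ^ 2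
      = ‖x - m‖ ^ 2 - 2 * (s * inner ℝ (x - m) v) + s ^ 2 * ‖v‖ ^ 2 := by
    intro s
    rw [sub_right_comm, norm_sub_sq_real, real_inner_smul_right, norm_smul, mul_pow,
      Real.norm_eq_abs, sq_abs]
  unfold gaussDensity gaussKernel
  simp_rw [e]
  have h1 : HasDerivAt (fun s : ℝ => -(1 / (2 * σ ^ 2)) *
      (‖x - m‖ ^ 2 - 2 * (s * inner ℝ (x - m) v) + s ^ 2 * ‖v‖ ^ 2))
      (-(1 / (2 * σ ^ 2)) * (0 - 2 * (1 * inner ℝ (x - m) v) + (2 : ℕ) * t ^ (2 - 1) * ‖v‖ ^ 2))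
      t :=
    ((((hasDerivAt_const t _).sub (((hasDerivAt_id t).mul_const _).const_mul 2)).add
      ((hasDerivAt_pow 2 t).mul_const _))).const_mul _
  have h2 : (inner ℝ (x - m) v - t * ‖v‖ ^ 2) / σ ^ 2
      = -(1 / (2 * σ ^ 2))
        * (0 - 2 * (1 * inner ℝ (x - m) v) + (2 : ℕ) * t ^ (2 - 1) * ‖v‖ ^ 2) := by
    push_cast
    field_simp
    ring
  refine (h1.exp.const_mul _).congr_deriv ?_
  rw [h2]
  ring

/-- Translating by at most `v` costs a constant factor and half of the Gaussian exponent, because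
`‖u‖² ≤ 2 ‖u - t v‖² + 2 ‖t v‖²`. -/
theorem gaussKernel_sub_smul_le (hσ : 0 < σ) (v x : EuclideanSpace ℝ (Fin n)) {t : ℝ}
    (ht : |t| ≤ 1) :
    gaussKernel m σ (x - t • v)
      ≤ Real.exp (1 / (2 * σ ^ 2) * ‖v‖ ^ 2) * Real.exp (-(1 / (4 * σ ^ 2)) * ‖x - m‖ ^ 2) := by
  rw [gaussKernel, ← Real.exp_add, Real.exp_le_exp]
  have h1 : ‖x - m‖ ≤ ‖x - t • v - m‖ + ‖v‖ := by
    have h2 : ‖t • v‖ ≤ ‖v‖ := by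
      rw [norm_smul, Real.norm_eq_abs]
      exact mul_le_of_le_one_left (norm_nonneg _) ht
    have h3 : x - m = (x - t • v - m) + t • v := by abel
    calc ‖x - m‖ = ‖(x - t • v - m) + t • v‖ := by rw [← h3]
      _ ≤ ‖x - t • v - m‖ + ‖t • v‖ := norm_add_le _ _
      _ ≤ _ := by linarith
  have h4 : ‖x - m‖ ^ 2 ≤ 2 * ‖x - t • v - m‖ ^ 2 + 2 * ‖v‖ ^ 2 := by
    nlinarith [norm_nonneg (x - m), sq_nonneg (‖x - t • v - m‖ - ‖v‖)]
  have h5 : (0 : ℝ) < 1 / (4 * σ ^ 2) := by positivity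
  have h6 : 1 / (2 * σ ^ 2) = 2 * (1 / (4 * σ ^ 2)) := by field_simp; norm_num
  rw [h6]
  nlinarith [mul_le_mul_of_nonneg_left h4 h5.le]

theorem abs_le_of_lipschitzWith {C : NNReal} {g : EuclideanSpace ℝ (Fin n) → ℝ}
    (hg : LipschitzWith C g) (x : EuclideanSpace ℝ (Fin n)) :
    |g x| ≤ (|g m| + C) * (1 + ‖x - m‖) := by
  have h1 := hg.dist_le_mul x m
  rw [dist_eq_norm, dist_eq_norm, Real.norm_eq_abs] at h1
  have h2 : |g x| ≤ |g x - g m| + |g m| := by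
    simpa using abs_add_le (g x - g m) (g m)
  nlinarith [abs_nonneg (g m), norm_nonneg (x - m), C.2,
    mul_nonneg (abs_nonneg (g m)) (norm_nonneg (x - m))]

theorem integrable_mul_gaussDensity (hσ : 0 < σ) {C : NNReal}
    {g : EuclideanSpace ℝ (Fin n) → ℝ} (hg : LipschitzWith C g) :
    Integrable fun x => g x * gaussDensity m σ x := by
  have hZ : 0 < (∫ z, gaussKernel m σ z)⁻¹ := inv_pos.2 (integral_gaussKernel_pos m hσ)
  have hb : (0 : ℝ) < 1 / (2 * σ ^ 2) := by positivity
  have hint := (integrable_one_add_sq_norm_mul_exp (n := n) hb).comp_sub_right m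
  refine Integrable.mono' (hint.const_mul (2 * (|g m| + C) * (∫ z, gaussKernel m σ z)⁻¹))
    (hg.continuous.mul (continuous_gaussDensity m σ)).aestronglyMeasurable
    (Filter.Eventually.of_forall fun x => ?_)
  have h2 : 1 + ‖x - m‖ ≤ 2 * (1 + ‖x - m‖ ^ 2) := by nlinarith [sq_nonneg (‖x - m‖ - 1)]
  rw [Real.norm_eq_abs, abs_mul, abs_of_nonneg (gaussDensity_nonneg m σ _)]
  calc |g x| * gaussDensity m σ x
      ≤ ((|g m| + C) * (2 * (1 + ‖x - m‖ ^ 2))) * gaussDensity m σ x :=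
        mul_le_mul_of_nonneg_right ((abs_le_of_lipschitzWith m hg x).trans
          (mul_le_mul_of_nonneg_left h2 (by positivity))) (gaussDensity_nonneg m σ _)
    _ = _ := by rw [gaussDensity, gaussKernel]; ring

/-- Differentiation under the integral sign; for `|t| ≤ 1` the integrand's derivative is dominated
by a multiple of `(1 + ‖x - m‖²) exp (-‖x - m‖² / (4σ²))`. -/
theorem hasDerivAt_integral_mul_gaussDensity (hσ : 0 < σ) {C : NNReal}
    {g : EuclideanSpace ℝ (Fin n) → ℝ} (hg : LipschitzWith C g) (v : EuclideanSpace ℝ (Fin n)) :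
    HasDerivAt (fun t : ℝ => ∫ x, g x * gaussDensity m σ (x - t • v))
      (∫ x, g x * (inner ℝ (x - m) v / σ ^ 2 * gaussDensity m σ x)) 0 := by
  have hg_le := abs_le_of_lipschitzWith m hg
  set Z := (∫ z, gaussKernel m σ z)⁻¹ with hZ
  have hZpos : 0 < Z := inv_pos.2 (integral_gaussKernel_pos m hσ)
  set D : ℝ := (|g m| + C) * (‖v‖ * (1 + ‖v‖)) / σ ^ 2 * Z
    * Real.exp (1 / (2 * σ ^ 2) * ‖v‖ ^ 2) with hD
  have hcont : ∀ t : ℝ, Continuous fun x => gaussDensity m σ (x - t • v) := fun t =>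
    (continuous_gaussDensity m σ).comp (by fun_prop)
  have hdens : ∀ (x : EuclideanSpace ℝ (Fin n)) (t : ℝ), |t| ≤ 1 →
      gaussDensity m σ (x - t • v) ≤ Z * (Real.exp (1 / (2 * σ ^ 2) * ‖v‖ ^ 2)
        * Real.exp (-(1 / (4 * σ ^ 2)) * ‖x - m‖ ^ 2)) := fun x t ht =>
    mul_le_mul_of_nonneg_left (gaussKernel_sub_smul_le m hσ v x ht) hZpos.le
  have hb : (0 : ℝ) < 1 / (4 * σ ^ 2) := by positivity
  have hint := (integrable_one_add_sq_norm_mul_exp (n := n) hb).comp_sub_right m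
  have hmain := hasDerivAt_integral_of_dominated_loc_of_deriv_le (μ := volume)
    (F := fun t x => g x * gaussDensity m σ (x - t • v))
    (F' := fun t x => g x * ((inner ℝ (x - m) v - t * ‖v‖ ^ 2) / σ ^ 2
      * gaussDensity m σ (x - t • v)))
    (x₀ := (0 : ℝ)) (s := Set.Icc (-1) 1)
    (bound := fun x => 2 * D * ((1 + ‖x - m‖ ^ 2)
      * Real.exp (-(1 / (4 * σ ^ 2)) * ‖x - m‖ ^ 2)))
    (Icc_mem_nhds (by norm_num) (by norm_num))
    (Filter.Eventually.of_forall fun t => (hg.continuous.mul (hcont t)).aestronglyMeasurable)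
    ?_ ?_ ?_ (hint.const_mul (2 * D)) ?_
  · simpa using hmain.2
  · simpa using integrable_mul_gaussDensity m hσ hg
  · refine Continuous.aestronglyMeasurable ?_
    have := hg.continuous
    have := hcont 0
    fun_prop
  · refine Filter.Eventually.of_forall fun x t ht => ?_
    have ht1 : |t| ≤ 1 := abs_le.2 ht
    have h1 := hdens x t ht1
    have h2 : |inner ℝ (x - m) v - t * ‖v‖ ^ 2| ≤ ‖v‖ * (1 + ‖v‖) * (1 + ‖x - m‖) := by
      have h3 := abs_real_inner_le_norm (x - m) v
      have h4 : |t * ‖v‖ ^ 2| ≤ ‖v‖ ^ 2 := by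
        rw [abs_mul, abs_of_nonneg (sq_nonneg ‖v‖)]
        exact mul_le_of_le_one_left (sq_nonneg _) ht1
      have h5 := abs_sub (inner ℝ (x - m) v) (t * ‖v‖ ^ 2)
      nlinarith [norm_nonneg v, norm_nonneg (x - m),
        mul_nonneg (mul_nonneg (norm_nonneg v) (norm_nonneg v)) (norm_nonneg (x - m))]
    rw [Real.norm_eq_abs, abs_mul, abs_mul, abs_div, abs_of_nonneg (gaussDensity_nonneg m σ _),
      abs_of_pos (by positivity : 0 < σ ^ 2)]
    have h6 : (1 + ‖x - m‖) * (1 + ‖x - m‖) ≤ 2 * (1 + ‖x - m‖ ^ 2) := by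
      nlinarith [sq_nonneg (‖x - m‖ - 1)]
    calc |g x| * (|inner ℝ (x - m) v - t * ‖v‖ ^ 2| / σ ^ 2 * gaussDensity m σ (x - t • v))
        ≤ ((|g m| + C) * (1 + ‖x - m‖)) * ((‖v‖ * (1 + ‖v‖) * (1 + ‖x - m‖)) / σ ^ 2
          * (Z * (Real.exp (1 / (2 * σ ^ 2) * ‖v‖ ^ 2)
            * Real.exp (-(1 / (4 * σ ^ 2)) * ‖x - m‖ ^ 2)))) := by
          refine mul_le_mul (hg_le x) (mul_le_mul ?_ h1 (gaussDensity_nonneg m σ _) (by positivity))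
            (mul_nonneg (by positivity) (gaussDensity_nonneg m σ _)) (by positivity)
          gcongr
      _ = D * Real.exp (-(1 / (4 * σ ^ 2)) * ‖x - m‖ ^ 2)
            * ((1 + ‖x - m‖) * (1 + ‖x - m‖)) := by rw [hD]; ring
      _ ≤ D * Real.exp (-(1 / (4 * σ ^ 2)) * ‖x - m‖ ^ 2) * (2 * (1 + ‖x - m‖ ^ 2)) :=
          mul_le_mul_of_nonneg_left h6 (by positivity)
      _ = _ := by ring
  · exact Filter.Eventually.of_forall fun x t _ =>
      (hasDerivAt_gaussDensity_sub_smul m hσ v x t).const_mul (g x)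

/-- **Stein's lemma** for a real Lipschitz function `g` and a direction `v`:
`E[g(Y) ⟨Y - m, v⟩] = σ² E[∂_v g(Y)]` for `Y ∼ N(m, σ² I)`. Both sides are the derivative at `t = 0`
of `E[g(Y + t v)]`: the derivative may be taken on `g`, or, after a translation, on the density. -/
theorem integral_mul_inner_multivariateGaussian (hσ : 0 < σ) {C : NNReal}
    {g : EuclideanSpace ℝ (Fin n) → ℝ} (hg : LipschitzWith C g) (v : EuclideanSpace ℝ (Fin n)) :
    ∫ x, g x * inner ℝ (x - m) v ∂multivariateGaussian m (σ ^ 2 • (1 : Matrix (Fin n) (Fin n) ℝ))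
      = σ ^ 2 * ∫ x, lineDeriv ℝ g x v
          ∂multivariateGaussian m (σ ^ 2 • (1 : Matrix (Fin n) (Fin n) ℝ)) := by
  rw [integral_multivariateGaussian m hσ, integral_multivariateGaussian m hσ]
  have hA := hg.integral_inv_smul_sub_mul_tendsto_integral_lineDeriv_mul
    (integrable_gaussDensity m hσ) v
  have hD := hasDerivAt_integral_mul_gaussDensity m hσ hg v
  have hB : Filter.Tendsto (fun t : ℝ => t⁻¹ • ((∫ x, g x * gaussDensity m σ (x - t • v))
      - ∫ x, g x * gaussDensity m σ x)) (nhdsWithin 0 (Set.Ioi 0))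
      (nhds (∫ x, g x * (inner ℝ (x - m) v / σ ^ 2 * gaussDensity m σ x))) := by
    have := hD.tendsto_slope_zero_right
    simpa using this
  have hint (w : EuclideanSpace ℝ (Fin n)) :
      Integrable fun x => g (x + w) * gaussDensity m σ x := by
    have hw : LipschitzWith (C * 1) fun x => g (x + w) :=
      hg.comp (isometry_add_right w).lipschitz
    exact integrable_mul_gaussDensity m hσ hw
  have heq : ∀ t : ℝ, ∫ x, (t⁻¹ • (g (x + t • v) - g x)) * gaussDensity m σ x
      = t⁻¹ • ((∫ x, g x * gaussDensity m σ (x - t • v)) - ∫ x, g x * gaussDensity m σ x) := by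
    intro t
    have h1 : ∫ x, g x * gaussDensity m σ (x - t • v)
        = ∫ x, g (x + t • v) * gaussDensity m σ x := by
      rw [← integral_add_right_eq_self _ (t • v)]
      simp
    have h2 := hint 0
    simp only [add_zero] at h2
    rw [h1, ← integral_sub (hint _) h2, smul_eq_mul, ← integral_const_mul]
    congr 1
    ext x
    rw [smul_eq_mul]
    ring
  simp_rw [heq] at hA
  rw [← tendsto_nhds_unique hB hA, ← integral_const_mul]
  congr 1
  ext x
  field_simp

end Stein

/-! ### Covariance, divergence and risk of a Lipschitz fit under the Gaussian law -/

section Risk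

variable {n : ℕ} {m : EuclideanSpace ℝ (Fin n)} {σ : ℝ} {C : NNReal}
  {f : EuclideanSpace ℝ (Fin n) → EuclideanSpace ℝ (Fin n)}

theorem memLp_two_of_lipschitzWith (hf : LipschitzWith C f) :
    MemLp f 2 (multivariateGaussian m (σ ^ 2 • (1 : Matrix (Fin n) (Fin n) ℝ))) := by
  have h := LipschitzWith.comp_memLp (g := fun x => f x - f 0) (f := id)
    (p := 2) (μ := multivariateGaussian m (σ ^ 2 • (1 : Matrix (Fin n) (Fin n) ℝ)))
    (K := C) (LipschitzWith.of_dist_le_mul fun x y => by simpa using hf.dist_le_mul x y)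
    (by simp) IsGaussian.memLp_two_id
  have e : f = (fun x => f x - f 0) ∘ id + fun _ => f 0 := by
    funext x
    simp
  rw [e]
  exact h.add (memLp_const (f 0))

theorem integrable_inner_sub (hf : LipschitzWith C f) :
    Integrable (fun x => inner ℝ (x - m) (f x))
      (multivariateGaussian m (σ ^ 2 • (1 : Matrix (Fin n) (Fin n) ℝ))) := by
  have h1 : MemLp (fun x : EuclideanSpace ℝ (Fin n) => x - m) 2
      (multivariateGaussian m (σ ^ 2 • (1 : Matrix (Fin n) (Fin n) ℝ))) :=
    IsGaussian.memLp_two_id.sub (memLp_const m)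
  have h2 := memLp_two_of_lipschitzWith (m := m) (σ := σ) hf
  exact (h1.norm.integrable_mul h2.norm).mono' (h1.1.inner h2.1)
    (Filter.Eventually.of_forall fun x => norm_inner_le_norm _ _)

theorem lipschitzWith_coord (hf : LipschitzWith C f) (i : Fin n) :
    LipschitzWith C fun x => f x i :=
  LipschitzWith.of_dist_le_mul fun x y => by
    refine le_trans ?_ (hf.dist_le_mul x y)
    rw [dist_eq_norm, dist_eq_norm]
    exact PiLp.norm_apply_le (f x - f y) i

theorem integrable_lineDeriv_coord (hf : LipschitzWith C f) (i : Fin n) :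
    Integrable (fun x => lineDeriv ℝ (fun y => f y i) x (EuclideanSpace.single i 1))
      (multivariateGaussian m (σ ^ 2 • (1 : Matrix (Fin n) (Fin n) ℝ))) :=
  ((lipschitzWith_coord hf i).memLp_lineDeriv _).integrable le_top

theorem ae_divergence_eq_sum_lineDeriv (hσ : 0 < σ) (hf : LipschitzWith C f) :
    ∀ᵐ x ∂multivariateGaussian m (σ ^ 2 • (1 : Matrix (Fin n) (Fin n) ℝ)),
      divergence f x = ∑ i, lineDeriv ℝ (fun y => f y i) x (EuclideanSpace.single i 1) := by
  filter_upwards [(multivariateGaussian_absolutelyContinuous m hσ).ae_le hf.ae_differentiableAt]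
    with x hx
  refine Finset.sum_congr rfl fun i _ => ?_
  have h := (EuclideanSpace.proj (𝕜 := ℝ) i).hasFDerivAt.comp x hx.hasFDerivAt
  exact (h.hasLineDerivAt (EuclideanSpace.single i 1)).lineDeriv.symm

theorem integrable_divergence (hσ : 0 < σ) (hf : LipschitzWith C f) :
    Integrable (divergence f)
      (multivariateGaussian m (σ ^ 2 • (1 : Matrix (Fin n) (Fin n) ℝ))) :=
  (integrable_finsetSum Finset.univ fun i _ => integrable_lineDeriv_coord hf i).congr
    ((ae_divergence_eq_sum_lineDeriv hσ hf).mono fun _ h => h.symm)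

/-- Stein's identity `E⟨Y - m, f(Y)⟩ = σ² E[div f(Y)]` for a Lipschitz vector field `f`. -/
theorem integral_inner_sub_eq_integral_divergence (hσ : 0 < σ) (hf : LipschitzWith C f) :
    ∫ x, inner ℝ (x - m) (f x)
        ∂multivariateGaussian m (σ ^ 2 • (1 : Matrix (Fin n) (Fin n) ℝ))
      = σ ^ 2 * ∫ x, divergence f x
          ∂multivariateGaussian m (σ ^ 2 • (1 : Matrix (Fin n) (Fin n) ℝ)) := by
  rw [integral_congr_ae (ae_divergence_eq_sum_lineDeriv hσ hf),
    integral_finsetSum _ fun i _ => integrable_lineDeriv_coord hf i, Finset.mul_sum]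
  have e : ∀ x : EuclideanSpace ℝ (Fin n), inner ℝ (x - m) (f x)
      = ∑ i, f x i * inner ℝ (x - m) (EuclideanSpace.single i (1 : ℝ)) := by
    intro x
    rw [PiLp.inner_apply]
    refine Finset.sum_congr rfl fun i _ => ?_
    simp [EuclideanSpace.inner_single_right]
  simp_rw [e]
  rw [integral_finsetSum]
  · exact Finset.sum_congr rfl fun i _ =>
      integral_mul_inner_multivariateGaussian m hσ (lipschitzWith_coord hf i) _
  · intro i _
    have h1 : MemLp (fun x : EuclideanSpace ℝ (Fin n) => x - m) 2
        (multivariateGaussian m (σ ^ 2 • (1 : Matrix (Fin n) (Fin n) ℝ))) :=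
      IsGaussian.memLp_two_id.sub (memLp_const m)
    have h2 : MemLp (fun x => f x i) 2
        (multivariateGaussian m (σ ^ 2 • (1 : Matrix (Fin n) (Fin n) ℝ))) :=
      (EuclideanSpace.proj (𝕜 := ℝ) i).comp_memLp' (memLp_two_of_lipschitzWith hf)
    exact h2.integrable_mul (h1.inner_const _)

theorem divergence_id (x : EuclideanSpace ℝ (Fin n)) : divergence (fun y => y) x = n := by
  simp [divergence]

theorem integrable_norm_sub_sq (hf : LipschitzWith C f) :
    Integrable (fun x => ‖f x - m‖ ^ 2)
      (multivariateGaussian m (σ ^ 2 • (1 : Matrix (Fin n) (Fin n) ℝ))) :=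
  ((memLp_two_of_lipschitzWith hf).sub (memLp_const m)).integrable_norm_pow two_ne_zero

theorem integrable_norm_residual_sq (hf : LipschitzWith C f) :
    Integrable (fun x => ‖f x - x‖ ^ 2)
      (multivariateGaussian m (σ ^ 2 • (1 : Matrix (Fin n) (Fin n) ℝ))) :=
  ((memLp_two_of_lipschitzWith hf).sub IsGaussian.memLp_two_id).integrable_norm_pow two_ne_zero

theorem integrable_steinSURE (hσ : 0 < σ) (hf : LipschitzWith C f) :
    Integrable (steinSURE σ f)
      (multivariateGaussian m (σ ^ 2 • (1 : Matrix (Fin n) (Fin n) ℝ))) :=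
  ((integrable_const _).add ((integrable_norm_residual_sq hf).const_mul _)).add
    ((integrable_divergence hσ hf).const_mul _)

/-- Unbiasedness of Stein's risk estimate. In the expansion
`‖f - Y‖² = ‖f - m‖² - 2(⟨Y - m, f⟩ - ⟨Y - m, m⟩) + ‖Y - m‖²`, where
`‖Y - m‖² = ⟨Y - m, Y⟩ - ⟨Y - m, m⟩`, Stein's identity is
applied to `f`, to the identity (of divergence `n`) and to the constant `m` (of divergence `0`). -/
theorem integral_steinSURE (hn : 0 < n) (hσ : 0 < σ) (hf : LipschitzWith C f) :
    ∫ x, steinSURE σ f x ∂multivariateGaussian m (σ ^ 2 • (1 : Matrix (Fin n) (Fin n) ℝ))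
      = ∫ x, 1 / (n : ℝ) * ‖f x - m‖ ^ 2
          ∂multivariateGaussian m (σ ^ 2 • (1 : Matrix (Fin n) (Fin n) ℝ)) := by
  set γ := multivariateGaussian m (σ ^ 2 • (1 : Matrix (Fin n) (Fin n) ℝ)) with hγ
  have hn' : (n : ℝ) ≠ 0 := by exact_mod_cast hn.ne'
  have hid : LipschitzWith 1 fun x : EuclideanSpace ℝ (Fin n) => x := LipschitzWith.id
  have hconst : LipschitzWith 0 fun _ : EuclideanSpace ℝ (Fin n) => m := LipschitzWith.const m
  have h1 := integral_inner_sub_eq_integral_divergence (m := m) hσ hf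
  have h4 : ∫ x, inner ℝ (x - m) m ∂γ = 0 := by
    have h5 := integral_inner_sub_eq_integral_divergence (m := m) hσ hconst
    simpa [divergence] using h5
  have h2 : ∫ x, ‖x - m‖ ^ 2 ∂γ = σ ^ 2 * n := by
    have h3 := integral_inner_sub_eq_integral_divergence (m := m) hσ hid
    simp only [divergence_id, integral_const, probReal_univ, one_smul] at h3
    have e : ∀ x : EuclideanSpace ℝ (Fin n),
        ‖x - m‖ ^ 2 = inner ℝ (x - m) x - inner ℝ (x - m) m := fun x => by
      rw [← inner_sub_right, real_inner_self_eq_norm_sq]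
    simp_rw [e]
    rw [integral_sub (integrable_inner_sub hid) (integrable_inner_sub hconst),
      h3, h4, sub_zero]
  have e : ∀ x : EuclideanSpace ℝ (Fin n), ‖f x - x‖ ^ 2
      = ‖f x - m‖ ^ 2 - 2 * (inner ℝ (x - m) (f x) - inner ℝ (x - m) m) + ‖x - m‖ ^ 2 := by
    intro x
    have : f x - x = (f x - m) - (x - m) := by abel
    rw [this, norm_sub_sq_real, ← inner_sub_right, real_inner_comm]
  have i1 := integrable_norm_sub_sq (m := m) (σ := σ) hf
  have i2 := integrable_inner_sub (m := m) (σ := σ) hf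
  have i3 := integrable_inner_sub (m := m) (σ := σ) hconst
  have i4 := integrable_norm_sub_sq (m := m) (σ := σ) hid
  have h6 : ∫ x, ‖f x - x‖ ^ 2 ∂γ = ∫ x, ‖f x - m‖ ^ 2 ∂γ
      - 2 * (σ ^ 2 * ∫ x, divergence f x ∂γ) + σ ^ 2 * n := by
    have i5 : Integrable (fun x => 2 * (inner ℝ (x - m) (f x) - inner ℝ (x - m) m)) γ :=
      (i2.sub i3).const_mul 2
    have i6 : Integrable (fun x => ‖f x - m‖ ^ 2
        - 2 * (inner ℝ (x - m) (f x) - inner ℝ (x - m) m)) γ := i1.sub i5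
    simp_rw [e]
    rw [integral_add i6 i4, integral_sub i1 i5, integral_const_mul, integral_sub i2 i3, h1, h2,
      h4, sub_zero]
  have h7 : ∫ x, steinSURE σ f x ∂γ = -σ ^ 2 + 1 / (n : ℝ) * ∫ x, ‖f x - x‖ ^ 2 ∂γ
      + 2 * σ ^ 2 / (n : ℝ) * ∫ x, divergence f x ∂γ := by
    have i5 : Integrable (fun x => 1 / (n : ℝ) * ‖f x - x‖ ^ 2) γ :=
      (integrable_norm_residual_sq hf).const_mul _
    have i6 : Integrable (fun x => -σ ^ 2 + 1 / (n : ℝ) * ‖f x - x‖ ^ 2) γ :=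
      (integrable_const _).add i5
    unfold steinSURE
    rw [integral_add i6 ((integrable_divergence hσ hf).const_mul _),
      integral_add (integrable_const _) i5, integral_const_mul, integral_const_mul]
    simp
  rw [h7, h6, integral_const_mul]
  field_simp
  ring

end Risk

theorem lavaSURE_eq {n p : ℕ} (X : Matrix (Fin n) (Fin p) ℝ) (lam₂ σ : ℝ)
    (y : EuclideanSpace ℝ (Fin n)) (β δ : EuclideanSpace ℝ (Fin p)) :
    lavaSURE X lam₂ σ y β δ = -σ ^ 2 + (1 / (n : ℝ)) * ‖apply X (β + δ) - y‖ ^ 2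
      + (2 * σ ^ 2 / (n : ℝ)) * dfTerm X lam₂ δ := by
  rw [lavaSURE, dfTerm]
  ring

end Lava

theorem theorem3p2 {Ω : Type*} [MeasurableSpace Ω] (P : Measure Ω) {n p : ℕ} (hn : 0 < n)
    (X : Matrix (Fin n) (Fin p) ℝ) (θ₀ : EuclideanSpace ℝ (Fin p))
    (σ : ℝ) (hσ : 0 < σ) (lam₁ lam₂ : ℝ) (hlam₁ : 0 ≤ lam₁) (hlam₂ : 0 ≤ lam₂)
    (hgram : IsUnit (Lava.ridgeGram X lam₂))
    (Y : Ω → EuclideanSpace ℝ (Fin n))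
    (hY : HasLaw Y (multivariateGaussian (Lava.apply X θ₀)
      (σ ^ 2 • (1 : Matrix (Fin n) (Fin n) ℝ))) P)
    (βhat δhat : EuclideanSpace ℝ (Fin n) → EuclideanSpace ℝ (Fin p))
    (hlava : ∀ y, Lava.IsLavaSolution X lam₁ lam₂ y (βhat y) (δhat y)) :
    -- degrees of freedom
    (Integrable (fun ω => inner ℝ (Y ω - Lava.apply X θ₀)
        (Lava.apply X (βhat (Y ω) + δhat (Y ω)))) P ∧
      Integrable (fun ω => Lava.dfTerm X lam₂ (δhat (Y ω))) P ∧
      Lava.degreesOfFreedom P Y (Lava.apply X θ₀) σ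
          (fun y => Lava.apply X (βhat y + δhat y))
        = ∫ ω, Lava.dfTerm X lam₂ (δhat (Y ω)) ∂P) ∧
    -- the explicit expression is Stein's unbiased risk estimate of the lava fit
    (∀ᵐ ω ∂P,
      DifferentiableAt ℝ (fun y => Lava.apply X (βhat y + δhat y)) (Y ω) ∧
      Lava.steinSURE σ (fun y => Lava.apply X (βhat y + δhat y)) (Y ω)
        = Lava.lavaSURE X lam₂ σ (Y ω) (βhat (Y ω)) (δhat (Y ω))) ∧
    -- and it is unbiased for the prediction risk
    (Integrable (fun ω => (1 / (n : ℝ)) *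
        ‖Lava.apply X (βhat (Y ω) + δhat (Y ω)) - Lava.apply X θ₀‖ ^ 2) P ∧
      Integrable (fun ω => Lava.lavaSURE X lam₂ σ (Y ω) (βhat (Y ω)) (δhat (Y ω))) P ∧
      ∫ ω, Lava.lavaSURE X lam₂ σ (Y ω) (βhat (Y ω)) (δhat (Y ω)) ∂P
        = ∫ ω, (1 / (n : ℝ)) *
            ‖Lava.apply X (βhat (Y ω) + δhat (Y ω)) - Lava.apply X θ₀‖ ^ 2 ∂P) := by
  set γ := multivariateGaussian (Lava.apply X θ₀) (σ ^ 2 • (1 : Matrix (Fin n) (Fin n) ℝ)) with hγ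
  set f : EuclideanSpace ℝ (Fin n) → EuclideanSpace ℝ (Fin n) :=
    fun y => Lava.apply X (βhat y + δhat y) with hf
  have hlip : LipschitzWith 1 f := Lava.lipschitzWith_fit hn hlam₁ hlam₂ hlava
  have hae : ∀ᵐ y ∂γ, DifferentiableAt ℝ f y ∧
      Lava.divergence f y = Lava.dfTerm X lam₂ (δhat y) :=
    (Lava.multivariateGaussian_absolutelyContinuous _ hσ).ae_le
      (Lava.ae_differentiableAt_and_divergence_eq hn hlam₁ hlam₂ hgram hlava)
  have haeY : ∀ᵐ ω ∂P, DifferentiableAt ℝ f (Y ω) ∧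
      Lava.divergence f (Y ω) = Lava.dfTerm X lam₂ (δhat (Y ω)) := by
    rw [← hY.map_eq] at hae
    exact ae_of_ae_map hY.aemeasurable hae
  have hsure : ∀ᵐ ω ∂P, Lava.steinSURE σ f (Y ω)
      = Lava.lavaSURE X lam₂ σ (Y ω) (βhat (Y ω)) (δhat (Y ω)) := by
    filter_upwards [haeY] with ω hω
    rw [Lava.lavaSURE_eq, Lava.steinSURE, hω.2]
  have hint {g : EuclideanSpace ℝ (Fin n) → ℝ} (hg : Integrable g γ) :
      Integrable (fun ω => g (Y ω)) P := by
    rw [← hY.map_eq] at hg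
    exact hg.comp_aemeasurable hY.aemeasurable
  have heq {g : EuclideanSpace ℝ (Fin n) → ℝ} (hg : Integrable g γ) :
      ∫ ω, g (Y ω) ∂P = ∫ y, g y ∂γ := hY.integral_comp hg.aestronglyMeasurable
  have i1 := Lava.integrable_inner_sub (m := Lava.apply X θ₀) (σ := σ) hlip
  have i2 := Lava.integrable_divergence (m := Lava.apply X θ₀) hσ hlip
  have i3 := (Lava.integrable_norm_sub_sq (m := Lava.apply X θ₀) (σ := σ) hlip).const_mul
    (1 / (n : ℝ))
  have i4 := Lava.integrable_steinSURE (m := Lava.apply X θ₀) hσ hlip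
  refine ⟨⟨hint i1, (hint i2).congr (haeY.mono fun _ h => h.2), ?_⟩, ?_,
    hint i3, (hint i4).congr hsure, ?_⟩
  · rw [Lava.degreesOfFreedom, heq i1, Lava.integral_inner_sub_eq_integral_divergence hσ hlip,
      ← integral_congr_ae (haeY.mono fun _ h => h.2), heq i2, one_div,
      inv_mul_cancel_left₀ (pow_ne_zero 2 hσ.ne')]
  · filter_upwards [haeY, hsure] with ω h1 h2 using ⟨h1.1, h2⟩
  · rw [← integral_congr_ae hsure, heq i4, Lava.integral_steinSURE hn hσ hlip]
    exact (heq i3).symm
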